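/- Let $E$ be a real Banach lattice, with norm dual $E'$ (a Banach lattice under the order $f\le g \iff f(x)\le g(x)$ for all $x\ge 0$ and the operator norm). A norm is \emph{order continuous} if $\|x_\alpha\|\to 0$ for every net $x_\alpha\downarrow 0$. A net $(x'_\alpha)$ in $E'$ is called - $uaw^*$-null if $|x'_\alpha|\wedge u'\to 0$ in $\sigma(E',E)$ for every $0\le u'\in E'$; - $uaw$-null if $|x'_\alpha|\wedge u'\to 0$ in $\sigma(E',E'')$ for every $0\le u'\in E'$; - $uo$-null if $|x'_\alpha|\wedge u'\to 0$ in order for every $0\le u'\in E'$, where $z_\alpha\to 0$ in order means that there is a net $y_\beta\downarrow 0$ such that for every $\beta$ one has $|z_\alpha|\le y_\beta$ for all sufficiently large $\alpha$; - $un$-null if $\big\||x'_\alpha|\wedge u'\big\|\to 0$ for every $0\le u'\in E'$; - weak*-null if $x'_\alpha(x)\to 0$ for every $x\in E$; - $|\sigma|(E',E)$-null if $|x'_\alpha|(|x|)\to 0$ for every $x\in E$. **Theorem.** The following are equivalent: 1. $E$ has order continuous norm; 2. every norm bounded $uaw^*$-null net in $E'$ is weak*-null; 3. every norm bounded $uaw^*$-null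 net in $E'$ is $|\sigma|(E',E)$-null; 4. every norm bounded $uaw^*$-null sequence in $E'$ is weak*-null; 5. every norm bounded $uaw^*$-null sequence in $E'$ is $|\sigma|(E',E)$-null; 6. every norm bounded $uaw$-null net in $E'$ is weak*-null; 7. every norm bounded $uaw$-null net in $E'$ is $|\sigma|(E',E)$-null; 8. every norm bounded $uaw$-null sequence in $E'$ is weak*-null; 9. every norm bounded $uaw$-null sequence in $E'$ is $|\sigma|(E',E)$-null; 10. every norm bounded $uo$-null net in $E'$ is weak*-null; 11. every norm bounded $uo$-null net in $E'$ is $|\sigma|(E',E)$-null; 12. every norm bounded $uo$-null sequence in $E'$ is weak*-null; 13. every norm bounded $uo$-null sequence in $E'$ is $|\sigma|(E',E)$-null. If, in addition, $E'$ has order continuous norm, then conditions 1–13 are also equivalent to each of 14. every norm bounded $un$-null net in $E'$ is weak*-null; 15. every norm bounded $un$-null net in $E'$ is $|\sigma|(E',E)$-null; 16. every norm bounded $un$-null sequence in $E'$ is weak*-null; 17. every norm bounded $un$-null sequence in $E'$ is $|\sigma|(E',E)$-null. -/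

import Mathlib

open Filter Topology

/-! ### The dual of a normed lattice as a normed lattice

For a real normed lattice `E` the norm dual `E' = StrongDual ℝ E` is ordered by
`f ≤ g ↔ ∀ x ≥ 0, f x ≤ g x` and is a lattice by the Riesz–Kantorovich construction; its norm is
the operator norm, which is a solid (lattice) norm. -/

namespace DualLattice

section Construction

set_option linter.unusedSectionVars false

variable {E : Type*} [NormedAddCommGroup E] [NormedSpace ℝ E] [Lattice E] [HasSolidNorm E]
  [IsOrderedAddMonoid E]

theorem norm_le_of_nonneg_of_le {x y : E} (hy : 0 ≤ y) (hyx : y ≤ x) : ‖y‖ ≤ ‖x‖ := by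
  apply norm_le_norm_of_abs_le_abs
  rwa [abs_of_nonneg hy, abs_of_nonneg (hy.trans hyx)]

/-- The Riesz–Kantorovich formula `f⁺(x) = sup {f y : 0 ≤ y ≤ x}`, meaningful for `x ≥ 0`. -/
noncomputable def posFun (f : StrongDual ℝ E) (x : E) : ℝ := sSup (f '' Set.Icc 0 x)

theorem apply_le_of_mem (f : StrongDual ℝ E) {x y : E} (hy : 0 ≤ y) (hyx : y ≤ x) :
    f y ≤ ‖f‖ * ‖x‖ :=
  (le_abs_self _).trans <| (f.le_opNorm y).trans <|
    mul_le_mul_of_nonneg_left (norm_le_of_nonneg_of_le hy hyx) (norm_nonneg _)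

theorem bddAbove_image (f : StrongDual ℝ E) (x : E) : BddAbove (f '' Set.Icc 0 x) := by
  refine ⟨‖f‖ * ‖x‖, ?_⟩
  rintro _ ⟨y, hy, rfl⟩
  exact apply_le_of_mem f hy.1 hy.2

theorem le_posFun (f : StrongDual ℝ E) {x y : E} (hy : 0 ≤ y) (hyx : y ≤ x) :
    f y ≤ posFun f x :=
  le_csSup (bddAbove_image f x) ⟨y, ⟨hy, hyx⟩, rfl⟩

theorem posFun_le (f : StrongDual ℝ E) {x : E} (hx : 0 ≤ x) {c : ℝ}
    (h : ∀ y, 0 ≤ y → y ≤ x → f y ≤ c) : posFun f x ≤ c := by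
  refine csSup_le ⟨f 0, 0, ⟨le_rfl, hx⟩, rfl⟩ ?_
  rintro _ ⟨y, hy, rfl⟩
  exact h y hy.1 hy.2

theorem posFun_nonneg (f : StrongDual ℝ E) {x : E} (hx : 0 ≤ x) : 0 ≤ posFun f x := by
  simpa using le_posFun f le_rfl hx

theorem posFun_add (f : StrongDual ℝ E) {x y : E} (hx : 0 ≤ x) (hy : 0 ≤ y) :
    posFun f (x + y) = posFun f x + posFun f y := by
  apply le_antisymm
  · refine posFun_le f (add_nonneg hx hy) fun z hz hzxy => ?_
    have h1 : f (z ⊓ x) ≤ posFun f x := le_posFun f (le_inf hz hx) inf_le_right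
    have h2 : f (z - z ⊓ x) ≤ posFun f y := by
      refine le_posFun f (sub_nonneg.2 inf_le_left) ?_
      rw [sub_le_iff_le_add, ← sub_le_iff_le_add', le_inf_iff]
      exact ⟨sub_le_self _ hy, by rwa [sub_le_iff_le_add]⟩
    have h3 : f z = f (z ⊓ x) + f (z - z ⊓ x) := by rw [← map_add]; congr 1; abel
    linarith
  · rw [← le_sub_iff_add_le]
    refine posFun_le f hx fun a ha hax => ?_
    rw [le_sub_comm]
    refine posFun_le f hy fun b hb hby => ?_
    rw [le_sub_iff_add_le', ← map_add]
    exact le_posFun f (add_nonneg ha hb) (add_le_add hax hby)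

theorem posFun_sub_eq (f : StrongDual ℝ E) {a b c d : E} (ha : 0 ≤ a) (hb : 0 ≤ b) (hc : 0 ≤ c)
    (hd : 0 ≤ d) (h : a - b = c - d) :
    posFun f a - posFun f b = posFun f c - posFun f d := by
  have h1 : a + d = c + b := by rw [sub_eq_sub_iff_add_eq_add] at h; exact h
  have h2 := congrArg (posFun f) h1
  rw [posFun_add f ha hd, posFun_add f hc hb] at h2
  linarith

/-- The extension `x ↦ f⁺(x⁺) - f⁺(x⁻)` of `posFun f` to `E`, as an additive map. -/
noncomputable def posHom (f : StrongDual ℝ E) : E →+ ℝ :=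
  AddMonoidHom.mk' (fun x => posFun f x⁺ - posFun f x⁻) <| by
    intro x y
    have h : posFun f (x + y)⁺ - posFun f (x + y)⁻
        = posFun f (x⁺ + y⁺) - posFun f (x⁻ + y⁻) := by
      refine posFun_sub_eq f (posPart_nonneg _) (negPart_nonneg _)
        (add_nonneg (posPart_nonneg _) (posPart_nonneg _))
        (add_nonneg (negPart_nonneg _) (negPart_nonneg _)) ?_
      rw [posPart_sub_negPart, add_sub_add_comm, posPart_sub_negPart, posPart_sub_negPart]
    rw [h, posFun_add f (posPart_nonneg _) (posPart_nonneg _),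
      posFun_add f (negPart_nonneg _) (negPart_nonneg _)]
    ring

theorem norm_posHom_le (f : StrongDual ℝ E) (x : E) : ‖posHom f x‖ ≤ ‖f‖ * ‖x‖ := by
  have key : ∀ z : E, 0 ≤ z → z ≤ |x| → posFun f z ≤ ‖f‖ * ‖x‖ := fun z hz hzx =>
    posFun_le f hz fun y hy hyz => by
      simpa only [norm_abs_eq_norm] using apply_le_of_mem f hy (hyz.trans hzx)
  have h1 := key x⁺ (posPart_nonneg x) (sup_le (le_abs_self x) (abs_nonneg x))
  have h2 := key x⁻ (negPart_nonneg x) (sup_le (neg_le_abs x) (abs_nonneg x))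
  have h3 := posFun_nonneg f (posPart_nonneg x)
  have h4 := posFun_nonneg f (negPart_nonneg x)
  have h5 : posHom f x = posFun f x⁺ - posFun f x⁻ := rfl
  rw [h5, Real.norm_eq_abs, abs_le]
  constructor <;> linarith

/-- The positive part `f⁺` of a functional `f ∈ E'`. -/
noncomputable def posDual (f : StrongDual ℝ E) : StrongDual ℝ E :=
  (posHom f).toRealLinearMap
    (AddMonoidHomClass.continuous_of_bound (posHom f) ‖f‖ (norm_posHom_le f))

theorem posDual_apply (f : StrongDual ℝ E) {x : E} (hx : 0 ≤ x) : posDual f x = posFun f x := by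
  have h : posDual f x = posFun f x⁺ - posFun f x⁻ := rfl
  have h0 : posFun f 0 = 0 :=
    le_antisymm (posFun_le f le_rfl fun y h1 h2 => by
      rw [le_antisymm h2 h1, map_zero]) (posFun_nonneg f le_rfl)
  rw [h, posPart_of_nonneg hx, negPart_of_nonneg hx, h0, sub_zero]

noncomputable instance instPartialOrder : PartialOrder (StrongDual ℝ E) where
  le f g := ∀ x : E, 0 ≤ x → f x ≤ g x
  le_refl f x _ := le_rfl
  le_trans f g h h1 h2 x hx := (h1 x hx).trans (h2 x hx)
  le_antisymm f g h1 h2 := by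
    ext x
    have h : ∀ z : E, 0 ≤ z → f z = g z := fun z hz => le_antisymm (h1 z hz) (h2 z hz)
    rw [← posPart_sub_negPart x, map_sub, map_sub, h _ (posPart_nonneg x),
      h _ (negPart_nonneg x)]

theorem le_def {f g : StrongDual ℝ E} : f ≤ g ↔ ∀ x : E, 0 ≤ x → f x ≤ g x := Iff.rfl

instance instIsOrderedAddMonoid : IsOrderedAddMonoid (StrongDual ℝ E) where
  add_le_add_left f g h k x hx := by
    simpa using h x hx

/-- The lattice operations of `E'`: `f ⊔ g = (f - g)⁺ + g` and `f ⊓ g = -((-f) ⊔ (-g))`. -/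
noncomputable instance instLattice : Lattice (StrongDual ℝ E) where
  sup f g := posDual (f - g) + g
  le_sup_left f g x hx := by
    have h := le_posFun (f - g) hx le_rfl
    rw [sub_apply] at h
    rw [add_apply, posDual_apply _ hx]
    linarith
  le_sup_right f g x hx := by
    have h := posFun_nonneg (f - g) hx
    rw [add_apply, posDual_apply _ hx]
    linarith
  sup_le f g h h1 h2 x hx := by
    rw [add_apply, posDual_apply _ hx, ← le_sub_iff_add_le]
    refine posFun_le _ hx fun y hy hyx => ?_
    have a1 := h1 y hy
    have a2 := h2 (x - y) (sub_nonneg.2 hyx)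
    rw [map_sub, map_sub] at a2
    rw [sub_apply]
    linarith
  inf f g := -(posDual (-f - -g) + -g)
  inf_le_left f g x hx := by
    have h := le_posFun (-f - -g) hx le_rfl
    simp only [sub_apply, neg_apply] at h
    simp only [add_apply, neg_apply, posDual_apply _ hx]
    linarith
  inf_le_right f g x hx := by
    have h := posFun_nonneg (-f - -g) hx
    simp only [add_apply, neg_apply, posDual_apply _ hx]
    linarith
  le_inf f g h h1 h2 x hx := by
    simp only [add_apply, neg_apply, posDual_apply _ hx]
    rw [le_neg, ← le_sub_iff_add_le]
    refine posFun_le _ hx fun y hy hyx => ?_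
    have a1 := h1 y hy
    have a2 := h2 (x - y) (sub_nonneg.2 hyx)
    rw [map_sub, map_sub] at a2
    simp only [sub_apply, neg_apply]
    linarith

theorem abs_apply_le (f : StrongDual ℝ E) (x : E) : |f x| ≤ |f| |x| := by
  have key : ∀ z : E, 0 ≤ z → |f z| ≤ |f| z := fun z hz =>
    abs_le'.2 ⟨le_abs_self f z hz, neg_le_abs f z hz⟩
  have h1 := key x⁺ (posPart_nonneg x)
  have h2 := key x⁻ (negPart_nonneg x)
  have h3 : |f x| ≤ |f x⁺| + |f x⁻| := by
    conv_lhs => rw [← posPart_sub_negPart x, map_sub]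
    exact abs_sub _ _
  have h4 : |f| |x| = |f| x⁺ + |f| x⁻ := by rw [← posPart_add_negPart x, map_add]
  linarith

theorem abs_apply_le_norm (f : StrongDual ℝ E) {x : E} (hx : 0 ≤ x) : |f| x ≤ ‖f‖ * ‖x‖ := by
  have h : |f| x = posFun (f - -f) x + (-f) x := by
    rw [← posDual_apply _ hx]; rfl
  rw [h, ← le_sub_iff_add_le]
  refine posFun_le _ hx fun y hy hyx => ?_
  have h1 : |y - (x - y)| ≤ |x| := by
    rw [abs_of_nonneg (hy.trans hyx), abs_le']
    constructor
    · rw [sub_le_iff_le_add]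
      exact hyx.trans (le_add_of_nonneg_right (sub_nonneg.2 hyx))
    · rw [neg_sub, sub_le_iff_le_add]
      exact (sub_le_self x hy).trans (le_add_of_nonneg_right hy)
  have h2 : f (y - (x - y)) ≤ ‖f‖ * ‖x‖ :=
    (le_abs_self _).trans <| (f.le_opNorm _).trans <|
      mul_le_mul_of_nonneg_left (norm_le_norm_of_abs_le_abs h1) (norm_nonneg _)
  simp only [map_sub] at h2
  simp only [sub_apply, neg_apply]
  linarith

instance instHasSolidNorm : HasSolidNorm (StrongDual ℝ E) where
  solid f g h := by
    refine ContinuousLinearMap.opNorm_le_bound _ (norm_nonneg _) fun x => ?_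
    calc ‖f x‖ ≤ |f| |x| := abs_apply_le f x
      _ ≤ |g| |x| := h _ (abs_nonneg x)
      _ ≤ ‖g‖ * ‖(|x| : E)‖ := abs_apply_le_norm g (abs_nonneg x)
      _ = ‖g‖ * ‖x‖ := by rw [norm_abs_eq_norm]

end Construction

end DualLattice

/-! ### Order continuous norms and modes of convergence of nets

A net is a family indexed by a nonempty directed preorder; limits along it are limits along
`atTop`. -/

universe u w

section Convergence

variable {ι : Type w}

/-- The net (or sequence) `x` is norm bounded. -/
def NormBounded {X : Type*} [NormedAddCommGroup X] (x : ι → X) : Prop :=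
  ∃ M : ℝ, ∀ a, ‖x a‖ ≤ M

variable [Preorder ι]

/-- `y ↓ 0`: the net `y` is decreasing and has infimum `0`. -/
def DecreasesToZero {X : Type*} [Preorder X] [Zero X] (y : ι → X) : Prop :=
  Antitone y ∧ IsGLB (Set.range y) 0

/-- The norm of `X` is order continuous: `‖y_α‖ → 0` for every net `y_α ↓ 0`. Index sets in the
universe of `X` suffice, since a decreasing net may be indexed by its range. -/
def OrderContinuousNorm (X : Type u) [NormedAddCommGroup X] [Lattice X] : Prop :=
  ∀ (Λ : Type u) [Preorder Λ] [IsDirectedOrder Λ] [Nonempty Λ] (y : Λ → X),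
    DecreasesToZero y → Tendsto (fun b => ‖y b‖) atTop (𝓝 0)

/-- `x_α → 0` in order: there is a net `y_β ↓ 0`, possibly over another index set, such that for
every `β` one has `|x_α| ≤ y_β` eventually. (Again `y` may be indexed by its range.) -/
def OrderNull {X : Type u} [AddCommGroup X] [Lattice X] (x : ι → X) : Prop :=
  ∃ (Λ : Type u) (_ : Preorder Λ) (_ : IsDirectedOrder Λ) (_ : Nonempty Λ) (y : Λ → X),
    DecreasesToZero y ∧ ∀ b, ∃ a₀, ∀ a, a₀ ≤ a → |x a| ≤ y b

/-- Unbounded order null nets. -/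
def UONull {X : Type u} [AddCommGroup X] [Lattice X] (x : ι → X) : Prop :=
  ∀ v : X, 0 ≤ v → OrderNull fun a => |x a| ⊓ v

/-- Unbounded norm null nets. -/
def UNNull {X : Type*} [NormedAddCommGroup X] [Lattice X] (x : ι → X) : Prop :=
  ∀ v : X, 0 ≤ v → Tendsto (fun a => ‖|x a| ⊓ v‖) atTop (𝓝 0)

/-- Unbounded absolute weak null nets: `|x_α| ∧ v → 0` in the weak topology, for all `v ≥ 0`. -/
def UAWNull {X : Type*} [NormedAddCommGroup X] [NormedSpace ℝ X] [Lattice X] (x : ι → X) : Prop :=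
  ∀ v : X, 0 ≤ v → Tendsto (fun a => toWeakSpace ℝ X (|x a| ⊓ v)) atTop (𝓝 0)

variable {E : Type u} [NormedAddCommGroup E] [NormedSpace ℝ E]

/-- `σ(E', E)`-null (weak* null) nets in `E'`. -/
def WeakStarNull (x : ι → StrongDual ℝ E) : Prop :=
  Tendsto (fun a => StrongDual.toWeakDual (x a)) atTop (𝓝 0)

variable [Lattice E] [HasSolidNorm E] [IsOrderedAddMonoid E]

/-- `|σ|(E', E)`-null nets in `E'`: convergence to `0` for the topology generated by the
seminorms `f ↦ |f|(|z|)`, `z ∈ E`. -/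
def AbsWeakStarNull (x : ι → StrongDual ℝ E) : Prop :=
  ∀ z : E, Tendsto (fun a => |x a| |z|) atTop (𝓝 0)

/-- Unbounded absolute weak* null nets in `E'`: `|x_α| ∧ v → 0` weak*, for all `0 ≤ v ∈ E'`. -/
def UAWStarNull (x : ι → StrongDual ℝ E) : Prop :=
  ∀ v : StrongDual ℝ E, 0 ≤ v → WeakStarNull fun a => |x a| ⊓ v

end Convergence

/-! The bridge is `HasControlFunctionals`: on each order interval the norm is controlled by single
positive functionals. For a Banach lattice this is equivalent to order continuity of the norm. Given
control, split `|x_a| ≤ |x_a| ⊓ nφ + (|x_a| - nφ)⁺`. The second term is uniformly small at `|z|` for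
large `n`, and the first tends to zero by the uaw* hypothesis (`UAWStarNull.absWeakStarNull`). Since
uaw-null, uo-null and un-null nets are all uaw*-null, order continuity yields every other condition.
If control fails, a recursion produces `y_n` in one interval and positive `f_n` in the unit ball
with `f_n (y_n) ≥ ε` and `f_m (y_n)` tiny for `m < n`. Subtracting multiples of the earlier
functionals and of one dominating functional, then taking positive parts, makes the `f_n` disjoint
without losing the lower bound (`exists_disjoint_seq_not_weakStarNull`). A disjoint sequence is both
uaw-null and uo-null, and also un-null when `E'` has order continuous norm, so this single sequence
refutes every condition. -/

namespace NormedLattice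

/-! ### Disjointness in vector lattices -/

section

variable {X : Type*} [AddCommGroup X] [Lattice X] [IsOrderedAddMonoid X]

theorem inf_add_eq_zero {a b c : X} (ha : 0 ≤ a) (hb : 0 ≤ b) (hc : 0 ≤ c) (h1 : c ⊓ a = 0)
    (h2 : c ⊓ b = 0) : c ⊓ (a + b) = 0 := by
  refine le_antisymm ?_ (le_inf hc (add_nonneg ha hb))
  rw [← h2]
  refine le_inf inf_le_left ?_
  rw [← sub_nonpos, ← h1]
  exact le_inf ((sub_le_self _ hb).trans inf_le_left) (sub_le_iff_le_add.2 inf_le_right)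

/-- The sum of pairwise disjoint elements below `v` stays below `v`. -/
theorem sum_range_le_of_disjoint {z : ℕ → X} (hz : ∀ n, 0 ≤ z n)
    (hd : ∀ m n, m < n → z m ⊓ z n = 0) {v : X} (hv : ∀ n, z n ≤ v) (k : ℕ) :
    ∑ n ∈ Finset.range k, z n ≤ v := by
  have hdisj : ∀ k n, k ≤ n → z n ⊓ ∑ i ∈ Finset.range k, z i = 0 := by
    intro k
    induction k with
    | zero => intro n _; simpa using hz n
    | succ k ih =>
      intro n hn
      rw [Finset.sum_range_succ]
      exact inf_add_eq_zero (Finset.sum_nonneg fun i _ => hz i) (hz k) (hz n)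
        (ih n (by omega)) (by rw [inf_comm]; exact hd k n (by omega))
  induction k with
  | zero => simpa using (hz 0).trans (hv 0)
  | succ k ih =>
    -- For disjoint elements the sum is the supremum.
    have h1 := inf_add_sup (z k) (∑ n ∈ Finset.range k, z n)
    rw [hdisj k k le_rfl, zero_add] at h1
    rw [Finset.sum_range_succ, add_comm, ← h1]
    exact sup_le (hv k) ih

/-- Positive and negative parts of one element are disjoint, and `h ≤ k • h` because `k ≥ 1`. -/
theorem inf_eq_zero_of_le_posPart_of_nsmul_le_negPart {g h p : X} (hg : 0 ≤ g) (hh : 0 ≤ h) (k : ℕ) (hk : 1 ≤ k)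
    (h1 : g ≤ p⁺) (h2 : k • h ≤ p⁻) : h ⊓ g = 0 := by
  refine le_antisymm ?_ (le_inf hh hg)
  rw [← posPart_inf_negPart_eq_zero p]
  refine le_inf (inf_le_right.trans h1) (inf_le_left.trans (le_trans ?_ h2))
  calc h = 1 • h := (one_nsmul h).symm
    _ ≤ k • h := nsmul_le_nsmul_left hh hk

end

/-! ### Order null nets and order continuous norms -/

section

variable {X : Type u} [NormedAddCommGroup X] [Lattice X] [HasSolidNorm X]

theorem tendsto_norm_of_orderNull {ι : Type w} [Preorder ι] [IsDirectedOrder ι] [Nonempty ι]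
    (hX : OrderContinuousNorm X) {x : ι → X} (hx : OrderNull x) :
    Tendsto (fun a => ‖x a‖) atTop (𝓝 0) := by
  obtain ⟨Λ, _, _, _, y, hy, h⟩ := hx
  have ht := hX Λ y hy
  rw [Metric.tendsto_nhds]
  intro ε hε
  obtain ⟨b, hb⟩ := (ht.eventually (gt_mem_nhds hε)).exists
  obtain ⟨a₀, ha⟩ := h b
  filter_upwards [eventually_ge_atTop a₀] with a haa
  rw [dist_zero_right, norm_norm]
  refine lt_of_le_of_lt ?_ hb
  refine norm_le_norm_of_abs_le_abs ((ha a haa).trans (le_abs_self _))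

end

section

variable {X : Type u} [NormedAddCommGroup X] [NormedSpace ℝ X] [Lattice X] [HasSolidNorm X]
  [IsOrderedAddMonoid X]

/-- Normed lattices are Archimedean: `k * ‖w‖ ≤ ‖y‖` for all `k` forces `‖w‖ = 0`. -/
theorem eq_zero_of_forall_nsmul_le {w y : X} (hw : 0 ≤ w) (h : ∀ k : ℕ, k • w ≤ y) : w = 0 := by
  by_contra hne
  have hpos : 0 < ‖w‖ := norm_pos_iff.2 hne
  obtain ⟨k, hk⟩ := exists_nat_gt (‖y‖ / ‖w‖)
  have h1 := DualLattice.norm_le_of_nonneg_of_le (nsmul_nonneg hw k) (h k)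
  rw [← Nat.cast_smul_eq_nsmul ℝ, norm_smul, Real.norm_natCast] at h1
  rw [div_lt_iff₀ hpos] at hk
  linarith

/-- A supremum need not exist a priori, so order continuity is applied to the differences `u - x n`,
with `u` running down through all upper bounds. -/
theorem cauchySeq_of_monotone_of_le (hX : OrderContinuousNorm X) {x : ℕ → X} (hx : Monotone x)
    {b : X} (hb : ∀ n, x n ≤ b) : CauchySeq x := by
  let U : Set X := upperBounds (Set.range x)
  have hU : ∀ {u : X}, u ∈ U ↔ ∀ n, x n ≤ u := by
    intro u; simp [U, upperBounds]
  have : IsDirectedOrder (U : Type u)ᵒᵈ := ⟨fun p q =>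
    ⟨OrderDual.toDual ⟨(OrderDual.ofDual p).1 ⊓ (OrderDual.ofDual q).1,
      hU.2 fun n => le_inf (hU.1 (OrderDual.ofDual p).2 n) (hU.1 (OrderDual.ofDual q).2 n)⟩,
      by exact (inf_le_left : (OrderDual.ofDual p).1 ⊓ _ ≤ _),
      by exact (inf_le_right : _ ⊓ (OrderDual.ofDual q).1 ≤ _)⟩⟩
  have : Nonempty (U : Type u)ᵒᵈ := ⟨OrderDual.toDual ⟨b, hU.2 hb⟩⟩
  have : IsDirectedOrder ((U : Type u)ᵒᵈ × ℕ) := ⟨fun p q => by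
    obtain ⟨c, h1, h2⟩ := exists_ge_ge p.1 q.1
    exact ⟨(c, max p.2 q.2), ⟨h1, le_max_left _ _⟩, ⟨h2, le_max_right _ _⟩⟩⟩
  let y : (U : Type u)ᵒᵈ × ℕ → X := fun p => (OrderDual.ofDual p.1).1 - x p.2
  have hy : DecreasesToZero y := by
    refine ⟨fun p q hpq => sub_le_sub (show (OrderDual.ofDual q.1).1 ≤ (OrderDual.ofDual p.1).1
      from hpq.1) (hx hpq.2), ?_, ?_⟩
    · rintro _ ⟨p, rfl⟩
      exact sub_nonneg.2 (hU.1 (OrderDual.ofDual p.1).2 _)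
    · intro w hw
      have hw' : ∀ u, (∀ n, x n ≤ u) → ∀ n, w⁺ ≤ u - x n := fun u hu n =>
        sup_le (hw ⟨(OrderDual.toDual ⟨u, hU.2 hu⟩, n), rfl⟩) (sub_nonneg.2 (hu n))
      -- If `w` lies below every difference, subtracting `w⁺` from an upper bound leaves an upper
      -- bound; iterating contradicts the Archimedean property unless `w⁺ = 0`.
      have hk : ∀ k : ℕ, ∀ n, x n ≤ b - k • w⁺ := by
        intro k
        induction k with
        | zero => simpa using hb
        | succ k ih =>
          intro n
          have := hw' _ ih n
          rw [succ_nsmul, ← sub_sub, le_sub_comm]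
          exact this
      have h0 : w⁺ = 0 := eq_zero_of_forall_nsmul_le (y := b - x 0) (posPart_nonneg w) fun k => by
        rw [le_sub_comm]; exact hk k 0
      rw [← posPart_eq_zero]
      exact h0
  have ht := hX _ y hy
  rw [Metric.cauchySeq_iff']
  intro ε hε
  obtain ⟨⟨p, N⟩, hp⟩ := eventually_atTop.1 (ht.eventually (gt_mem_nhds hε))
  refine ⟨N, fun n hn => ?_⟩
  refine lt_of_le_of_lt ?_ (hp (p, N) le_rfl)
  rw [dist_eq_norm]
  exact DualLattice.norm_le_of_nonneg_of_le (sub_nonneg.2 (hx hn))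
    (sub_le_sub_right (hU.1 (OrderDual.ofDual p).2 _) _)

/-- The dominating net consists of all eventual upper bounds, ordered downwards, which avoids any
order completeness. -/
theorem orderNull_of_disjoint {z : ℕ → X} (hz : ∀ n, 0 ≤ z n)
    (hd : ∀ m n, m < n → z m ⊓ z n = 0) {v : X} (hv : ∀ n, z n ≤ v) : OrderNull z := by
  let U : Set X := {u | ∀ᶠ n in atTop, z n ≤ u}
  have hU0 : ∀ u ∈ U, 0 ≤ u := fun u hu => by
    obtain ⟨n, hn⟩ := hu.exists
    exact (hz n).trans hn
  have hD : IsDirectedOrder (U : Type u)ᵒᵈ := ⟨fun p q =>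
    ⟨OrderDual.toDual ⟨(OrderDual.ofDual p).1 ⊓ (OrderDual.ofDual q).1, by
      filter_upwards [(OrderDual.ofDual p).2, (OrderDual.ofDual q).2] with n h1 h2
      exact le_inf h1 h2⟩,
      by exact (inf_le_left : (OrderDual.ofDual p).1 ⊓ _ ≤ _),
      by exact (inf_le_right : _ ⊓ (OrderDual.ofDual q).1 ≤ _)⟩⟩
  have hN : Nonempty (U : Type u)ᵒᵈ := ⟨OrderDual.toDual ⟨v, Eventually.of_forall hv⟩⟩
  refine ⟨(U : Type u)ᵒᵈ, inferInstance, hD, hN, fun p => (OrderDual.ofDual p).1,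
    ⟨fun p q hpq => hpq, ?_, ?_⟩, fun p => ?_⟩
  · rintro _ ⟨p, rfl⟩
    exact hU0 _ (OrderDual.ofDual p).2
  · intro w hw
    have hw' : ∀ u ∈ U, w⁺ ≤ u := fun u hu =>
      sup_le (hw ⟨OrderDual.toDual ⟨u, hu⟩, rfl⟩) (hU0 u hu)
    have hstep : ∀ u ∈ U, u - w⁺ ∈ U := by
      intro u hu
      obtain ⟨N, hN⟩ := eventually_atTop.1 hu
      refine eventually_atTop.2 ⟨N, fun i hi => ?_⟩
      rw [le_sub_comm]
      -- `u - z i` is again an eventual upper bound: for late `n`, disjointness gives `z i + z n = z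
      -- i ⊔ z n ≤ u`.
      refine hw' _ (eventually_atTop.2 ⟨i + 1, fun n hn => ?_⟩)
      have h1 := inf_add_sup (z i) (z n)
      rw [hd i n hn, zero_add] at h1
      rw [le_sub_iff_add_le', ← h1]
      exact sup_le (hN i hi) (hN n (by omega))
    have hk : ∀ k : ℕ, v - k • w⁺ ∈ U := by
      intro k
      induction k with
      | zero =>
        rw [zero_nsmul, sub_zero]
        exact Eventually.of_forall hv
      | succ k ih =>
        rw [succ_nsmul, ← sub_sub]
        exact hstep _ ih
    rw [← posPart_eq_zero]
    exact eq_zero_of_forall_nsmul_le (posPart_nonneg w) fun k => sub_nonneg.1 (hU0 _ (hk k))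
  · obtain ⟨N, hN⟩ := eventually_atTop.1 (OrderDual.ofDual p).2
    exact ⟨N, fun a ha => by rw [abs_of_nonneg (hz a)]; exact hN a ha⟩

end

end NormedLattice

namespace DualLattice

open NormedLattice

/-! ### Modes of convergence in the dual -/

section

variable {E : Type u} [NormedAddCommGroup E] [NormedSpace ℝ E]

theorem weakStarNull_iff {ι : Type w} [Preorder ι] {x : ι → StrongDual ℝ E} :
    WeakStarNull x ↔ ∀ z, Tendsto (fun a => x a z) atTop (𝓝 0) :=
  WeakBilin.tendsto_iff_forall_eval_tendsto (topDualPairing ℝ E)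
    (fun _ _ h => ContinuousLinearMap.coe_injective h)

theorem tendsto_toWeakSpace_zero_iff {ι : Type w} {l : Filter ι} {x : ι → E} :
    Tendsto (fun a => toWeakSpace ℝ E (x a)) l (𝓝 0) ↔
      ∀ φ : StrongDual ℝ E, Tendsto (fun a => φ (x a)) l (𝓝 0) := by
  have h := WeakBilin.tendsto_iff_forall_eval_tendsto (topDualPairing ℝ E).flip (l := l)
    (f := fun a => toWeakSpace ℝ E (x a)) (x := 0) fun a b hab => by
      refine (SeparatingDual.eq_iff_forall_dual_eq (R := ℝ)).2 fun g => ?_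
      exact LinearMap.congr_fun hab g
  refine h.trans (forall_congr' fun φ => ?_)
  exact show Tendsto (fun a => φ (x a)) l (𝓝 (φ 0)) ↔ _ by rw [map_zero]

variable [Lattice E]

theorem UNNull.uawNull {ι : Type w} [Preorder ι] {x : ι → E}
    (h : UNNull x) : UAWNull x := fun v hv =>
  tendsto_toWeakSpace_zero_iff.2 fun φ => by
    have := (φ.continuous.tendsto 0).comp (tendsto_zero_iff_norm_tendsto_zero.2 (h v hv))
    rwa [map_zero] at this

variable [IsOrderedAddMonoid E]

theorem weakStarNull_iff_of_nonneg {ι : Type w} [Preorder ι] {x : ι → StrongDual ℝ E} :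
    WeakStarNull x ↔ ∀ z, 0 ≤ z → Tendsto (fun a => x a z) atTop (𝓝 0) := by
  rw [weakStarNull_iff]
  refine ⟨fun h z _ => h z, fun h z => ?_⟩
  have h1 := (h z⁺ (posPart_nonneg z)).sub (h z⁻ (negPart_nonneg z))
  simpa [← map_sub, posPart_sub_negPart] using h1

theorem apply_mono {f : StrongDual ℝ E} (hf : 0 ≤ f) {a b : E} (h : a ≤ b) : f a ≤ f b := by
  have := hf (b - a) (sub_nonneg.2 h)
  rw [map_sub] at this
  simpa using this

theorem apply_nonneg {f : StrongDual ℝ E} (hf : 0 ≤ f) {a : E} (h : 0 ≤ a) : 0 ≤ f a :=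
  hf a h

variable [HasSolidNorm E]

theorem AbsWeakStarNull.weakStarNull {ι : Type w} [Preorder ι] {x : ι → StrongDual ℝ E}
    (h : AbsWeakStarNull x) : WeakStarNull x :=
  weakStarNull_iff.2 fun z => squeeze_zero_norm (fun a => abs_apply_le (x a) z) (h z)

theorem UAWNull.uawStarNull {ι : Type w} [Preorder ι] {x : ι → StrongDual ℝ E}
    (h : UAWNull x) : UAWStarNull x := fun v hv =>
  weakStarNull_iff.2 fun z => tendsto_toWeakSpace_zero_iff.1 (h v hv)
    (NormedSpace.inclusionInDoubleDual ℝ E z)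

/-- A net decreasing to `0` in the dual decreases to `0` pointwise on the positive cone. -/
theorem tendsto_apply_of_decreasesToZero {Λ : Type w} [Preorder Λ] [IsDirectedOrder Λ]
    [Nonempty Λ] {y : Λ → StrongDual ℝ E} (hy : DecreasesToZero y) {z : E} (hz : 0 ≤ z) :
    Tendsto (fun b => y b z) atTop (𝓝 0) := by
  have hpos : ∀ b, 0 ≤ y b := fun b => hy.2.1 ⟨b, rfl⟩
  have hcone : ∀ z : E, 0 ≤ z → Tendsto (fun b => y b z) atTop (𝓝 (⨅ b, y b z)) := fun z hz =>
    tendsto_atTop_ciInf (fun a b hab => hy.1 hab z hz)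
      ⟨0, by rintro _ ⟨b, rfl⟩; exact hpos b z hz⟩
  have hlim : ∀ z : E, Tendsto (fun b => y b z) atTop (𝓝 ((⨅ b, y b z⁺) - ⨅ b, y b z⁻)) := by
    intro z
    have h := (hcone z⁺ (posPart_nonneg z)).sub (hcone z⁻ (negPart_nonneg z))
    simpa [← map_sub, posPart_sub_negPart] using h
  let gl : E →ₗ[ℝ] ℝ := linearMapOfTendsto _ (fun b => (y b : E →ₗ[ℝ] ℝ)) (tendsto_pi_nhds.2 hlim)
  obtain ⟨b₀⟩ := ‹Nonempty Λ›
  have hgl : ∀ z, Tendsto (fun b => y b z) atTop (𝓝 (gl z)) := hlim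
  -- The pointwise limit is bounded because the tail lies in `[0, y b₀]`. It is then a lower bound
  -- of the net in the dual, hence at most zero.
  let g : StrongDual ℝ E := gl.mkContinuous ‖y b₀‖ fun z => by
    refine le_of_tendsto (hgl z).norm ?_
    filter_upwards [eventually_ge_atTop b₀] with b hb
    exact ((y b).le_opNorm z).trans (mul_le_mul_of_nonneg_right
      (norm_le_of_nonneg_of_le (hpos b) (hy.1 hb)) (norm_nonneg _))
  have hg0 : g ≤ 0 := by
    refine hy.2.2 ?_
    rintro _ ⟨b, rfl⟩ z hz
    exact Antitone.le_of_tendsto (fun a b hab => hy.1 hab z hz) (hgl z) b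
  have h1 : gl z ≤ 0 := hg0 z hz
  have h2 : 0 ≤ gl z := ge_of_tendsto' (hgl z) fun b => hpos b z hz
  rw [← le_antisymm h1 h2]
  exact hgl z

theorem OrderNull.weakStarNull {ι : Type w} [Preorder ι] [IsDirectedOrder ι] [Nonempty ι]
    {x : ι → StrongDual ℝ E} (h : OrderNull x) : WeakStarNull x := by
  obtain ⟨Λ, _, _, _, y, hy, h⟩ := h
  refine weakStarNull_iff_of_nonneg.2 fun z hz => ?_
  rw [Metric.tendsto_nhds]
  intro ε hε
  obtain ⟨b, hb⟩ :=
    ((tendsto_apply_of_decreasesToZero hy hz).eventually (gt_mem_nhds hε)).exists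
  obtain ⟨a₀, ha⟩ := h b
  filter_upwards [eventually_ge_atTop a₀] with a haa
  rw [dist_zero_right]
  have h1 := abs_apply_le (x a) z
  rw [abs_of_nonneg hz] at h1
  exact (h1.trans (ha a haa z hz)).trans_lt hb

theorem UONull.uawStarNull {ι : Type w} [Preorder ι] [IsDirectedOrder ι] [Nonempty ι]
    {x : ι → StrongDual ℝ E} (h : UONull x) : UAWStarNull x := fun v hv =>
  OrderNull.weakStarNull (h v hv)

/-! ### Control functionals and order continuity -/

theorem exists_nonneg_norming (y : E) (hy : 0 ≤ y) :
    ∃ f : StrongDual ℝ E, 0 ≤ f ∧ ‖f‖ ≤ 1 ∧ ‖y‖ ≤ f y := by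
  obtain ⟨g, hg, hgy⟩ := exists_dual_vector'' ℝ y
  refine ⟨|g|, abs_nonneg g, by rwa [norm_abs_eq_norm], ?_⟩
  have h := le_abs_self g y hy
  rw [hgy] at h
  exact h

/-- On every order interval `[0, x]`, each norm neighbourhood of `0` contains a set
`{y | φ y ≤ δ}` for some positive functional `φ`. -/
def HasControlFunctionals (E : Type u) [NormedAddCommGroup E] [NormedSpace ℝ E] [Lattice E]
    [HasSolidNorm E] [IsOrderedAddMonoid E] : Prop :=
  ∀ x : E, 0 ≤ x → ∀ ε : ℝ, 0 < ε → ∃ φ : StrongDual ℝ E, 0 ≤ φ ∧ ∃ δ : ℝ, 0 < δ ∧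
    ∀ y, 0 ≤ y → y ≤ x → φ y ≤ δ → ‖y‖ < ε

/-- Recursion: failure of control is tested against the sum of the functionals already chosen, and
the resulting `y` is normed by a new positive functional. The rate `1/8` is chosen to beat a later
factor `4 ^ n`. -/
theorem exists_seq_of_not_hasControlFunctionals (h : ¬ HasControlFunctionals E) :
    ∃ (x : E) (ε : ℝ) (y : ℕ → E) (f : ℕ → StrongDual ℝ E), 0 ≤ x ∧ 0 < ε ∧
      (∀ n, 0 ≤ y n) ∧ (∀ n, y n ≤ x) ∧ (∀ n, 0 ≤ f n) ∧ (∀ n, ‖f n‖ ≤ 1) ∧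
      (∀ n, ε ≤ f n (y n)) ∧ ∀ m n, m < n → f m (y n) ≤ (1 / 8) ^ n := by
  simp only [HasControlFunctionals, not_forall] at h
  obtain ⟨x, hx, ε, hε, h⟩ := h
  push Not at h
  obtain ⟨F, hP, hr⟩ := exists_seq_of_forall_finset_exists
    (fun t : E × StrongDual ℝ E × ℕ => 0 ≤ t.1 ∧ t.1 ≤ x ∧ 0 ≤ t.2.1 ∧ ‖t.2.1‖ ≤ 1 ∧
      ε ≤ t.2.1 t.1)
    (fun s t => s.2.2 < t.2.2 ∧ s.2.1 t.1 ≤ (1 / 8) ^ t.2.2) fun s hs => by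
      -- The finite-set choice principle supplies no index, so each triple carries a strictly
      -- increasing counter; the counter of the `n`th triple is at least `n`.
      let k := (s.sup fun t => t.2.2) + 1
      obtain ⟨y, hy0, hyx, hy, hn⟩ := h (∑ t ∈ s, t.2.1)
        (Finset.sum_nonneg fun t ht => (hs t ht).2.2.1) ((1 / 8) ^ k) (by positivity)
      obtain ⟨f, hf0, hf1, hfy⟩ := exists_nonneg_norming y hy0
      refine ⟨(y, f, k), ⟨hy0, hyx, hf0, hf1, hn.trans hfy⟩, fun t ht => ⟨?_, ?_⟩⟩
      · exact Nat.lt_succ_of_le (Finset.le_sup (f := fun t => t.2.2) ht)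
      · refine le_trans ?_ hy
        exact (Finset.single_le_sum (f := fun t : E × StrongDual ℝ E × ℕ => t.2.1)
          (fun t ht => (hs t ht).2.2.1) ht) y hy0
  have hmono : StrictMono fun n => (F n).2.2 := fun m n hmn => (hr m n hmn).1
  refine ⟨x, ε, fun n => (F n).1, fun n => (F n).2.1, hx, hε, fun n => (hP n).1,
    fun n => (hP n).2.1, fun n => (hP n).2.2.1, fun n => (hP n).2.2.2.1,
    fun n => (hP n).2.2.2.2, fun m n hmn => (hr m n hmn).2.trans ?_⟩
  exact pow_le_pow_of_le_one (by norm_num) (by norm_num) (hmono.id_le n)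

theorem sum_geometric_le (n m : ℕ) :
    ∑ k ∈ Finset.range m, (1 / 8 : ℝ) ^ (n + k) ≤ 2 * (1 / 8) ^ n := by
  have h : ∑ k ∈ Finset.range m, (1 / 8 : ℝ) ^ k ≤ 2 := by
    have := (summable_geometric_of_lt_one (r := (1 / 8 : ℝ)) (by norm_num) (by norm_num)).sum_le_tsum
      (Finset.range m) (fun _ _ => by positivity)
    rw [tsum_geometric_of_lt_one (by norm_num) (by norm_num)] at this
    norm_num at this ⊢
    linarith
  simp only [pow_add, ← Finset.mul_sum]
  nlinarith [pow_pos (show (0 : ℝ) < 1 / 8 by norm_num) n]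

/-- Order continuity makes the tail suprema `z n` of the bad sequence exist and converge in norm.
Every `f i` is at most zero at their limit, while `f n (z n) ≥ ε` with `‖f n‖ ≤ 1`. -/
theorem hasControlFunctionals_of_orderContinuousNorm [CompleteSpace E]
    (hE : OrderContinuousNorm E) : HasControlFunctionals E := by
  by_contra h
  obtain ⟨x, ε, y, f, hx, hε, hy0, hyx, hf0, hf1, hfy, hlt⟩ :=
    exists_seq_of_not_hasControlFunctionals h
  let s : ℕ → ℕ → E := fun n => partialSups fun k => y (n + k)
  have hsx : ∀ n m, s n m ≤ x := fun n m => partialSups_le _ _ _ fun k _ => hyx _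
  have hsum : ∀ n m, s n m ≤ ∑ k ∈ Finset.range (m + 1), y (n + k) := fun n m =>
    partialSups_le _ _ _ fun k hk => Finset.single_le_sum (f := fun k => y (n + k))
      (fun i _ => hy0 _) (Finset.mem_range.2 (Nat.lt_succ_of_le hk))
  choose z hz using fun n => cauchySeq_tendsto_of_complete
    (cauchySeq_of_monotone_of_le hE (partialSups fun k => y (n + k)).monotone (hsx n))
  have hz' : ∀ n m, s n m ≤ z n := fun n m =>
    Monotone.ge_of_tendsto (partialSups fun k => y (n + k)).monotone (hz n) m
  have hyz : ∀ n, y n ≤ z n := fun n =>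
    (le_partialSups (fun k => y (n + k)) 0).trans (hz' n 0)
  have hanti : Antitone z := antitone_nat_of_succ_le fun n =>
    le_of_tendsto' (hz (n + 1)) fun m => (partialSups_le _ _ _ fun k hk => by
      have := le_partialSups_of_le (fun k => y (n + k)) (show k + 1 ≤ m + 1 by omega)
      rwa [show n + (k + 1) = n + 1 + k by omega] at this).trans (hz' n (m + 1))
  have hfz : ∀ i n, i < n → f i (z n) ≤ 2 * (1 / 8) ^ n := fun i n hin =>
    le_of_tendsto' (((f i).continuous.tendsto _).comp (hz n)) fun m => by
      refine (apply_mono (hf0 i) (hsum n m)).trans ?_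
      rw [map_sum]
      exact (Finset.sum_le_sum fun k _ => hlt i (n + k) (by omega)).trans (sum_geometric_le n _)
  -- The decreasing sequence `z` is negated to fit the monotone lemma, so its limit is `-w`.
  obtain ⟨w, hw⟩ := cauchySeq_tendsto_of_complete
    (cauchySeq_of_monotone_of_le hE hanti.neg (b := 0)
      fun n => neg_nonpos.2 ((hy0 n).trans (hyz n)))
  have hw' : Tendsto z atTop (𝓝 (-w)) := by simpa using hw.neg
  have hfw : ∀ i, f i (-w) ≤ 0 := fun i => by
    have h1 : Tendsto (fun n : ℕ => 2 * (1 / 8 : ℝ) ^ n) atTop (𝓝 0) := by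
      simpa using (tendsto_pow_atTop_nhds_zero_of_lt_one (r := (1 / 8 : ℝ))
        (by norm_num) (by norm_num)).const_mul 2
    refine le_of_tendsto_of_tendsto (((f i).continuous.tendsto _).comp hw') h1 ?_
    filter_upwards [eventually_gt_atTop i] with n hn
    exact hfz i n hn
  have hd : Tendsto (fun n => ‖z n - -w‖) atTop (𝓝 0) := tendsto_iff_norm_sub_tendsto_zero.1 hw'
  obtain ⟨n, hn⟩ := (hd.eventually (gt_mem_nhds hε)).exists
  have h1 := apply_mono (hf0 n) (hyz n)
  have h2 : f n (z n - -w) ≤ ‖z n - -w‖ := by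
    refine (le_abs_self _).trans (((f n).le_opNorm _).trans ?_)
    exact mul_le_of_le_one_left (norm_nonneg _) (hf1 n)
  rw [map_sub] at h2
  linarith [hfy n, hfw n]

/-- A positive `φ` takes convergent values along a decreasing net, so control on `[0, y b₀]` makes
the net norm Cauchy; its limit is a lower bound. -/
theorem orderContinuousNorm_of_hasControlFunctionals [CompleteSpace E]
    (hE : HasControlFunctionals E) : OrderContinuousNorm E := by
  intro Λ _ _ _ y hy
  have hpos : ∀ b, 0 ≤ y b := fun b => hy.2.1 ⟨b, rfl⟩
  have hC : CauchySeq y := by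
    obtain ⟨b₀⟩ := ‹Nonempty Λ›
    refine Metric.cauchy_iff.2 ⟨inferInstance, fun ε hε => ?_⟩
    obtain ⟨φ, hφ, δ, hδ, h⟩ := hE (y b₀) (hpos b₀) (ε / 2) (half_pos hε)
    have hlim := tendsto_atTop_ciInf (f := fun b => φ (y b))
      (fun a b hab => apply_mono hφ (hy.1 hab)) ⟨0, by
        rintro _ ⟨b, rfl⟩; exact apply_nonneg hφ (hpos b)⟩
    have hle : ∀ b, ⨅ b, φ (y b) ≤ φ (y b) := fun b =>
      Antitone.le_of_tendsto (fun a b hab => apply_mono hφ (hy.1 hab)) hlim b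
    obtain ⟨b₁, h1, h2⟩ := ((hlim.eventually (gt_mem_nhds (lt_add_of_pos_right _ hδ))).and
      (eventually_ge_atTop b₀)).exists
    have hdist : ∀ b, b₁ ≤ b → dist (y b₁) (y b) < ε / 2 := fun b hb => by
      rw [dist_eq_norm]
      refine h _ (sub_nonneg.2 (hy.1 hb)) ((sub_le_self _ (hpos b)).trans (hy.1 h2)) ?_
      rw [map_sub]
      linarith [hle b]
    refine ⟨y '' Set.Ici b₁, image_mem_map (Ici_mem_atTop b₁), ?_⟩
    rintro _ ⟨a, ha, rfl⟩ _ ⟨b, hb, rfl⟩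
    linarith [dist_triangle_left (y a) (y b) (y b₁), hdist a ha, hdist b hb]
  obtain ⟨z, hz⟩ := cauchySeq_tendsto_of_complete hC
  have h0 : z ≤ 0 := hy.2.2 (by rintro _ ⟨b, rfl⟩; exact Antitone.le_of_tendsto hy.1 hz b)
  have h1 : 0 ≤ z := ge_of_tendsto' hz hpos
  rw [le_antisymm h0 h1] at hz
  simpa using hz.norm

theorem UAWStarNull.absWeakStarNull (hE : HasControlFunctionals E) {ι : Type w} [Preorder ι]
    {x : ι → StrongDual ℝ E} (hb : NormBounded x) (hx : UAWStarNull x) : AbsWeakStarNull x := by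
  intro z
  obtain ⟨M, hM⟩ := hb
  have hM' : ∀ a, ‖x a‖ ≤ max M 1 := fun a => (hM a).trans (le_max_left _ _)
  have hMpos : 0 < max M 1 := lt_of_lt_of_le one_pos (le_max_right _ _)
  generalize max M 1 = M at hM' hMpos
  rw [Metric.tendsto_nhds]
  intro ε hε
  obtain ⟨φ, hφ, δ, hδ, h⟩ := hE |z| (abs_nonneg z) (ε / (2 * M)) (by positivity)
  -- With `n * δ ≥ M * ‖z‖`, each `y` in `[0, |z|]` either has `φ y ≤ δ`, hence small norm, or
  -- satisfies `n * φ y ≥ |x a| y`.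
  obtain ⟨n, hn⟩ := exists_nat_ge (M * ‖z‖ / δ)
  rw [div_le_iff₀ hδ] at hn
  have key : ∀ a, posFun (|x a| - n • φ) |z| ≤ ε / 2 := fun a =>
    posFun_le _ (abs_nonneg z) fun y hy hyz => by
      have h1 : |x a| y ≤ ‖x a‖ * ‖y‖ := abs_apply_le_norm _ hy
      have h0 : 0 ≤ φ y := apply_nonneg hφ hy
      have h5 : (|x a| - n • φ) y = |x a| y - n * φ y := by simp
      rw [h5]
      have h6 := mul_le_mul_of_nonneg_right (hM' a) (norm_nonneg y)
      by_cases hc : φ y ≤ δ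
      · have h2 := h y hy hyz hc
        rw [lt_div_iff₀ (by positivity)] at h2
        have h3 : 0 ≤ (n : ℝ) * φ y := by positivity
        nlinarith
      · have h2 := norm_le_of_nonneg_of_le hy hyz
        rw [norm_abs_eq_norm] at h2
        have h3 : (n : ℝ) * δ ≤ n * φ y := by gcongr; linarith
        nlinarith
  have h1 := weakStarNull_iff.1 (hx (n • φ) (nsmul_nonneg hφ n)) |z|
  filter_upwards [h1.eventually (gt_mem_nhds (half_pos hε))] with a ha
  have h2 : |x a| ≤ |x a| ⊓ n • φ + posDual (|x a| - n • φ) := by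
    have h3 := inf_add_sup |x a| (n • φ)
    have h4 : |x a| ⊔ n • φ = posDual (|x a| - n • φ) + n • φ := rfl
    rw [h4, ← add_assoc] at h3
    exact (add_right_cancel h3).ge
  have h3 := h2 |z| (abs_nonneg z)
  rw [add_apply, posDual_apply _ (abs_nonneg z)] at h3
  rw [Real.dist_0_eq_abs, abs_of_nonneg (apply_nonneg (abs_nonneg (x a)) (abs_nonneg z))]
  linarith [key a]

end

end DualLattice

namespace DualLattice

open NormedLattice

/-! ### Sequences as nets indexed by `ULift ℕ` -/

section

variable {E : Type u}

theorem tendsto_ulift_down_atTop :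
    Tendsto (ULift.down : ULift.{w} ℕ → ℕ) atTop atTop :=
  tendsto_atTop.2 fun b => (eventually_ge_atTop (ULift.up b)).mono fun _ ha => ha

theorem tendsto_ulift_up_atTop :
    Tendsto (ULift.up : ℕ → ULift.{w} ℕ) atTop atTop :=
  tendsto_atTop.2 fun b => (eventually_ge_atTop b.down).mono fun _ ha => ha

theorem UONull.comp_ulift_down [AddCommGroup E] [Lattice E] {g : ℕ → E} (h : UONull g) :
    UONull fun a : ULift.{w} ℕ => g a.down := fun v hv => by
  obtain ⟨Λ, i1, i2, i3, y, hy, hb⟩ := h v hv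
  refine ⟨Λ, i1, i2, i3, y, hy, fun b => ?_⟩
  obtain ⟨a₀, ha⟩ := hb b
  exact ⟨ULift.up a₀, fun a haa => ha a.down haa⟩

variable [NormedAddCommGroup E]

theorem UNNull.comp_ulift_down [Lattice E] {g : ℕ → E} (h : UNNull g) :
    UNNull fun a : ULift.{w} ℕ => g a.down :=
  fun v hv => (h v hv).comp tendsto_ulift_down_atTop

variable [NormedSpace ℝ E]

theorem WeakStarNull.of_comp_ulift_down {g : ℕ → StrongDual ℝ E}
    (h : WeakStarNull fun a : ULift.{w} ℕ => g a.down) : WeakStarNull g :=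
  weakStarNull_iff.2 fun z => (weakStarNull_iff.1 h z).comp tendsto_ulift_up_atTop

theorem UAWNull.comp_ulift_down [Lattice E] {g : ℕ → E} (h : UAWNull g) :
    UAWNull fun a : ULift.{w} ℕ => g a.down :=
  fun v hv => (h v hv).comp tendsto_ulift_down_atTop

end

/-! ### Disjoint test sequences -/

section

variable {E : Type u} [NormedAddCommGroup E] [NormedSpace ℝ E] [Lattice E] [HasSolidNorm E]
  [IsOrderedAddMonoid E]

theorem exists_disjoint_seq_not_weakStarNull (h : ¬ HasControlFunctionals E) :
    ∃ g : ℕ → StrongDual ℝ E, (∀ n, 0 ≤ g n) ∧ (∀ m n, m < n → g m ⊓ g n = 0) ∧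
      NormBounded g ∧ ¬ WeakStarNull g := by
  obtain ⟨x, ε, y, f, hx, hε, hy0, hyx, hf0, hf1, hfy, hlt⟩ :=
    exists_seq_of_not_hasControlFunctionals h
  have hsummable : Summable fun i => (1 / 2 : ℝ) ^ i • f i :=
    Summable.of_norm_bounded (summable_geometric_of_lt_one (r := (1 / 2 : ℝ)) (by norm_num)
      (by norm_num)) fun i => by
        rw [norm_smul, norm_pow, Real.norm_of_nonneg (by norm_num)]
        exact mul_le_of_le_one_right (by positivity) (hf1 i)
  -- `H` is the sum of the series; completeness of the dual is what provides it.
  obtain ⟨H, hH⟩ : ∃ H : StrongDual ℝ E, ∀ i, (1 / 2 : ℝ) ^ i • f i ≤ H :=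
    ⟨_, fun i => hsummable.le_tsum i fun j _ z hz =>
      mul_nonneg (by positivity) (apply_nonneg (hf0 j) hz)⟩
  have hH' : ∀ i z, 0 ≤ z → (1 / 2 : ℝ) ^ i * f i z ≤ H z := fun i z hz => hH i z hz
  have hHn : ∀ z, 0 ≤ z → 0 ≤ H z := fun z hz => by
    refine le_trans ?_ (hH' 0 z hz)
    simpa using apply_nonneg (hf0 0) hz
  -- For `m < n` and `p = f n - 4 ^ n • f m`, the sum term gives `a n ≤ p`. The `H` term gives `4 ^
  -- n • a m ≤ -p`, because `f n ≤ 2 ^ n • H ≤ (4 ^ n / 2 ^ m) • H`. Thus the positive parts are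
  -- disjoint.
  let a : ℕ → StrongDual ℝ E := fun n =>
    f n - (4 : ℝ) ^ n • ∑ i ∈ Finset.range n, f i - (1 / 2 : ℝ) ^ n • H
  have ha : ∀ n z, a n z =
      f n z - 4 ^ n * ∑ i ∈ Finset.range n, f i z - (1 / 2) ^ n * H z := by
    intro n z
    simp [a]
  have hsum : ∀ n z, 0 ≤ z → 0 ≤ ∑ i ∈ Finset.range n, f i z := fun n z hz =>
    Finset.sum_nonneg fun i _ => apply_nonneg (hf0 i) hz
  have haf : ∀ n, a n ≤ f n := fun n z hz => by
    rw [ha]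
    have h1 := hsum n z hz
    have h2 := hHn z hz
    have h3 : 0 ≤ 4 ^ n * ∑ i ∈ Finset.range n, f i z := by positivity
    have h4 : 0 ≤ (1 / 2) ^ n * H z := by positivity
    linarith
  refine ⟨fun n => (a n)⁺, fun n => posPart_nonneg _, fun m n hmn => ?_, ⟨1, fun n => ?_⟩, ?_⟩
  · let p : StrongDual ℝ E := f n - (4 : ℝ) ^ n • f m
    have hp : ∀ z, p z = f n z - 4 ^ n * f m z := fun z => by simp [p]
    refine inf_eq_zero_of_le_posPart_of_nsmul_le_negPart (p := p) (posPart_nonneg _)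
      (posPart_nonneg _) (4 ^ n) (Nat.one_le_pow _ _ (by norm_num)) (posPart_mono fun z hz => ?_) ?_
    · rw [ha, hp]
      have h1 : f m z ≤ ∑ i ∈ Finset.range n, f i z :=
        Finset.single_le_sum (f := fun i => f i z) (fun i _ => apply_nonneg (hf0 i) hz)
          (Finset.mem_range.2 hmn)
      have h2 : (4 : ℝ) ^ n * f m z ≤ 4 ^ n * ∑ i ∈ Finset.range n, f i z := by gcongr
      have h4 : 0 ≤ (1 / 2) ^ n * H z := mul_nonneg (by positivity) (hHn z hz)
      linarith
    · have key : (a m)⁺ ≤ ((4 : ℝ) ^ n)⁻¹ • p⁻ := by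
        refine sup_le (fun z hz => ?_) fun z hz =>
          mul_nonneg (by positivity) (apply_nonneg (negPart_nonneg p) hz)
        have h1 : -p z ≤ p⁻ z := neg_le_negPart p z hz
        rw [hp] at h1
        rw [smul_apply, smul_eq_mul, ha, ← div_eq_inv_mul, le_div_iff₀ (by positivity)]
        have h2 : 0 ≤ 4 ^ m * ∑ i ∈ Finset.range m, f i z :=
          mul_nonneg (by positivity) (hsum m z hz)
        have h3 : f n z ≤ (1 / 2) ^ m * H z * 4 ^ n := by
          have h5 : (1 / 2 : ℝ) ^ n ≤ (1 / 2) ^ m :=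
            pow_le_pow_of_le_one (by norm_num) (by norm_num) hmn.le
          have h6 : (4 : ℝ) ^ n * (1 / 2) ^ n * (1 / 2) ^ n = 1 := by
            rw [← mul_pow, ← mul_pow]; norm_num
          calc f n z = 4 ^ n * (1 / 2) ^ n * ((1 / 2) ^ n * f n z) := by
                rw [← mul_assoc, h6, one_mul]
            _ ≤ 4 ^ n * (1 / 2) ^ m * H z := by
                have := hH' n z hz
                have := hHn z hz
                have := apply_nonneg (hf0 n) hz
                gcongr
            _ = _ := by ring
        nlinarith [pow_pos (show (0 : ℝ) < 4 by norm_num) n]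
      intro z hz
      have h1 := key z hz
      rw [smul_apply, smul_eq_mul, ← div_eq_inv_mul, le_div_iff₀ (by positivity)] at h1
      simpa [mul_comm] using h1
  · exact (norm_le_of_nonneg_of_le (posPart_nonneg _) (sup_le (haf n) (hf0 n))).trans (hf1 n)
  · intro hw
    have h1 := weakStarNull_iff.1 hw x
    -- Evaluation at `y n ≤ x` bounds `(a n)⁺ x` below: the earlier functionals cost at most `4 ^ n
    -- * n * (1 / 8) ^ n`, and `H` costs a null term.
    have h2 : Tendsto (fun n : ℕ => ε - n * (1 / 2 : ℝ) ^ n - (1 / 2) ^ n * (‖H‖ * ‖x‖)) atTop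
        (𝓝 (ε - 0 - 0 * (‖H‖ * ‖x‖))) :=
      (tendsto_const_nhds.sub (tendsto_self_mul_const_pow_of_lt_one (by norm_num)
        (by norm_num))).sub ((tendsto_pow_atTop_nhds_zero_of_lt_one (by norm_num)
        (by norm_num)).mul_const _)
    have h3 : ε - 0 - 0 * (‖H‖ * ‖x‖) ≤ 0 := by
      refine le_of_tendsto_of_tendsto' h2 h1 fun n => ?_
      have e1 : a n (y n) ≤ (a n)⁺ (y n) := le_posPart (a n) (y n) (hy0 n)
      have e2 : (a n)⁺ (y n) ≤ (a n)⁺ x := apply_mono (posPart_nonneg _) (hyx n)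
      have e3 : H (y n) ≤ ‖H‖ * ‖x‖ := apply_le_of_mem H (hy0 n) (hyx n)
      have e4 : ∑ i ∈ Finset.range n, f i (y n) ≤ n * (1 / 8) ^ n := by
        simpa using Finset.sum_le_card_nsmul (Finset.range n) (fun i => f i (y n)) ((1 / 8) ^ n)
          fun i hi => hlt i n (Finset.mem_range.1 hi)
      have e5 : (4 : ℝ) ^ n * ∑ i ∈ Finset.range n, f i (y n) ≤ n * (1 / 2) ^ n :=
        calc (4 : ℝ) ^ n * ∑ i ∈ Finset.range n, f i (y n) ≤ 4 ^ n * (n * (1 / 8) ^ n) := by gcongr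
          _ = n * (4 * (1 / 8)) ^ n := by rw [mul_pow]; ring
          _ = n * (1 / 2) ^ n := by norm_num
      have e6 : (1 / 2 : ℝ) ^ n * H (y n) ≤ (1 / 2) ^ n * (‖H‖ * ‖x‖) := by gcongr
      rw [ha] at e1
      linarith [hfy n]
    linarith

/-- Partial sums of a disjoint sequence stay below `v`, so the series of `|φ| (z n)` converges. -/
theorem tendsto_apply_of_disjoint {z : ℕ → E} (hz : ∀ n, 0 ≤ z n)
    (hd : ∀ m n, m < n → z m ⊓ z n = 0) {v : E} (hv : ∀ n, z n ≤ v) (φ : StrongDual ℝ E) :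
    Tendsto (fun n => φ (z n)) atTop (𝓝 0) := by
  have hs : Summable fun n => |φ| (z n) :=
    summable_of_sum_range_le (c := |φ| v) (fun n => apply_nonneg (abs_nonneg φ) (hz n))
      fun k => by
        rw [← map_sum]
        exact apply_mono (abs_nonneg φ) (sum_range_le_of_disjoint hz hd hv k)
  refine squeeze_zero_norm (fun n => ?_) hs.tendsto_atTop_zero
  have := abs_apply_le φ (z n)
  rwa [abs_of_nonneg (hz n)] at this

theorem disjoint_abs_inf {X : Type*} [AddCommGroup X] [Lattice X] [IsOrderedAddMonoid X]
    {g : ℕ → X} (hg : ∀ n, 0 ≤ g n) (hd : ∀ m n, m < n → g m ⊓ g n = 0) {v : X} (hv : 0 ≤ v)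
    (m n : ℕ) (hmn : m < n) : (|g m| ⊓ v) ⊓ (|g n| ⊓ v) = 0 := by
  rw [abs_of_nonneg (hg m), abs_of_nonneg (hg n), ← inf_inf_distrib_right, hd m n hmn,
    inf_of_le_left hv]

theorem uawNull_of_disjoint {g : ℕ → E} (hg : ∀ n, 0 ≤ g n)
    (hd : ∀ m n, m < n → g m ⊓ g n = 0) : UAWNull g := fun _ hv =>
  tendsto_toWeakSpace_zero_iff.2 fun φ =>
    tendsto_apply_of_disjoint (fun n => le_inf (abs_nonneg (g n)) hv)
      (disjoint_abs_inf hg hd hv) (fun _ => inf_le_right) φ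

theorem uoNull_of_disjoint {g : ℕ → E} (hg : ∀ n, 0 ≤ g n)
    (hd : ∀ m n, m < n → g m ⊓ g n = 0) : UONull g := fun _ hv =>
  orderNull_of_disjoint (fun n => le_inf (abs_nonneg (g n)) hv)
    (disjoint_abs_inf hg hd hv) fun _ => inf_le_right

theorem UONull.unNull {X : Type u} [NormedAddCommGroup X] [Lattice X] [HasSolidNorm X]
    (hX : OrderContinuousNorm X) {ι : Type w} [Preorder ι] [IsDirectedOrder ι] [Nonempty ι]
    {x : ι → X} (hx : UONull x) : UNNull x := fun v hv => tendsto_norm_of_orderNull hX (hx v hv)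

end

end DualLattice

/-! ### The equivalences -/

open DualLattice NormedLattice

theorem mainTheorem1 (E : Type u) [NormedAddCommGroup E] [NormedSpace ℝ E] [CompleteSpace E]
    [Lattice E] [HasSolidNorm E] [IsOrderedAddMonoid E] [IsOrderedModule ℝ E] :
    let P : List Prop :=
      [ OrderContinuousNorm E,
        ∀ (ι : Type w) [Preorder ι] [IsDirectedOrder ι] [Nonempty ι] (x : ι → StrongDual ℝ E),
          NormBounded x → UAWStarNull x → WeakStarNull x,
        ∀ (ι : Type w) [Preorder ι] [IsDirectedOrder ι] [Nonempty ι] (x : ι → StrongDual ℝ E),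
          NormBounded x → UAWStarNull x → AbsWeakStarNull x,
        ∀ x : ℕ → StrongDual ℝ E, NormBounded x → UAWStarNull x → WeakStarNull x,
        ∀ x : ℕ → StrongDual ℝ E, NormBounded x → UAWStarNull x → AbsWeakStarNull x,
        ∀ (ι : Type w) [Preorder ι] [IsDirectedOrder ι] [Nonempty ι] (x : ι → StrongDual ℝ E),
          NormBounded x → UAWNull x → WeakStarNull x,
        ∀ (ι : Type w) [Preorder ι] [IsDirectedOrder ι] [Nonempty ι] (x : ι → StrongDual ℝ E),
          NormBounded x → UAWNull x → AbsWeakStarNull x,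
        ∀ x : ℕ → StrongDual ℝ E, NormBounded x → UAWNull x → WeakStarNull x,
        ∀ x : ℕ → StrongDual ℝ E, NormBounded x → UAWNull x → AbsWeakStarNull x,
        ∀ (ι : Type w) [Preorder ι] [IsDirectedOrder ι] [Nonempty ι] (x : ι → StrongDual ℝ E),
          NormBounded x → UONull x → WeakStarNull x,
        ∀ (ι : Type w) [Preorder ι] [IsDirectedOrder ι] [Nonempty ι] (x : ι → StrongDual ℝ E),
          NormBounded x → UONull x → AbsWeakStarNull x,
        ∀ x : ℕ → StrongDual ℝ E, NormBounded x → UONull x → WeakStarNull x,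
        ∀ x : ℕ → StrongDual ℝ E, NormBounded x → UONull x → AbsWeakStarNull x ]
    let Q : List Prop :=
      [ ∀ (ι : Type w) [Preorder ι] [IsDirectedOrder ι] [Nonempty ι] (x : ι → StrongDual ℝ E),
          NormBounded x → UNNull x → WeakStarNull x,
        ∀ (ι : Type w) [Preorder ι] [IsDirectedOrder ι] [Nonempty ι] (x : ι → StrongDual ℝ E),
          NormBounded x → UNNull x → AbsWeakStarNull x,
        ∀ x : ℕ → StrongDual ℝ E, NormBounded x → UNNull x → WeakStarNull x,
        ∀ x : ℕ → StrongDual ℝ E, NormBounded x → UNNull x → AbsWeakStarNull x ]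
    P.TFAE ∧ (OrderContinuousNorm (StrongDual ℝ E) → (P ++ Q).TFAE) := by
  intro P Q
  have abs_net : OrderContinuousNorm E → ∀ (ι : Type w) [Preorder ι] (x : ι → StrongDual ℝ E),
      NormBounded x → UAWStarNull x → AbsWeakStarNull x := fun h ι _ x hb hx =>
    UAWStarNull.absWeakStarNull (hasControlFunctionals_of_orderContinuousNorm h) hb hx
  have abs_seq : OrderContinuousNorm E → ∀ x : ℕ → StrongDual ℝ E,
      NormBounded x → UAWStarNull x → AbsWeakStarNull x := fun h x hb hx =>
    UAWStarNull.absWeakStarNull (hasControlFunctionals_of_orderContinuousNorm h) hb hx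
  -- It suffices to test disjoint sequences, which can also be indexed by `ULift ℕ`.
  have of_seq : (∀ g : ℕ → StrongDual ℝ E, NormBounded g → UAWNull g → UONull g →
      WeakStarNull g) → OrderContinuousNorm E := fun H => by
    refine orderContinuousNorm_of_hasControlFunctionals (by_contra fun hA => ?_)
    obtain ⟨g, hg, hd, hb, hw⟩ := exists_disjoint_seq_not_weakStarNull hA
    exact hw (H g hb (uawNull_of_disjoint hg hd) (uoNull_of_disjoint hg hd))
  have of_net : (∀ g : ULift.{w} ℕ → StrongDual ℝ E, NormBounded g → UAWNull g → UONull g →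
      WeakStarNull g) → OrderContinuousNorm E := fun H =>
    of_seq fun g ⟨M, hM⟩ h1 h2 => WeakStarNull.of_comp_ulift_down
      (H _ ⟨M, fun a => hM a.down⟩ h1.comp_ulift_down h2.comp_ulift_down)
  have hP : ∀ p ∈ P, (p ↔ OrderContinuousNorm E) := by
    simp only [P, List.forall_mem_cons, List.not_mem_nil, false_imp_iff, implies_true, and_true]
    refine ⟨trivial, ?_, ?_, ?_, ?_, ?_, ?_, ?_, ?_, ?_, ?_, ?_, ?_⟩
    · exact ⟨fun H => of_net fun g hb h1 _ => H _ g hb h1.uawStarNull,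
        fun h ι _ _ _ x hb hx => (abs_net h ι x hb hx).weakStarNull⟩
    · exact ⟨fun H => of_net fun g hb h1 _ => (H _ g hb h1.uawStarNull).weakStarNull,
        fun h ι _ _ _ x hb hx => abs_net h ι x hb hx⟩
    · exact ⟨fun H => of_seq fun g hb h1 _ => H g hb h1.uawStarNull,
        fun h x hb hx => (abs_seq h x hb hx).weakStarNull⟩
    · exact ⟨fun H => of_seq fun g hb h1 _ => (H g hb h1.uawStarNull).weakStarNull,
        fun h x hb hx => abs_seq h x hb hx⟩
    · exact ⟨fun H => of_net fun g hb h1 _ => H _ g hb h1,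
        fun h ι _ _ _ x hb hx => (abs_net h ι x hb hx.uawStarNull).weakStarNull⟩
    · exact ⟨fun H => of_net fun g hb h1 _ => (H _ g hb h1).weakStarNull,
        fun h ι _ _ _ x hb hx => abs_net h ι x hb hx.uawStarNull⟩
    · exact ⟨fun H => of_seq fun g hb h1 _ => H g hb h1,
        fun h x hb hx => (abs_seq h x hb hx.uawStarNull).weakStarNull⟩
    · exact ⟨fun H => of_seq fun g hb h1 _ => (H g hb h1).weakStarNull,
        fun h x hb hx => abs_seq h x hb hx.uawStarNull⟩
    · exact ⟨fun H => of_net fun g hb _ h2 => H _ g hb h2,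
        fun h ι _ _ _ x hb hx => (abs_net h ι x hb hx.uawStarNull).weakStarNull⟩
    · exact ⟨fun H => of_net fun g hb _ h2 => (H _ g hb h2).weakStarNull,
        fun h ι _ _ _ x hb hx => abs_net h ι x hb hx.uawStarNull⟩
    · exact ⟨fun H => of_seq fun g hb _ h2 => H g hb h2,
        fun h x hb hx => (abs_seq h x hb hx.uawStarNull).weakStarNull⟩
    · exact ⟨fun H => of_seq fun g hb _ h2 => (H g hb h2).weakStarNull,
        fun h x hb hx => abs_seq h x hb hx.uawStarNull⟩
  refine ⟨fun p hp q hq => (hP p hp).trans (hP q hq).symm, fun hE' => ?_⟩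
  -- Order continuity of `E'` serves only to make the disjoint test sequence un-null; the
  -- implications from order continuity of `E` hold without it.
  have hQ : ∀ q ∈ Q, (q ↔ OrderContinuousNorm E) := by
    simp only [Q, List.forall_mem_cons, List.not_mem_nil, false_imp_iff, implies_true, and_true]
    refine ⟨?_, ?_, ?_, ?_⟩
    · exact ⟨fun H => of_net fun g hb _ h2 => H _ g hb (h2.unNull hE'),
        fun h ι _ _ _ x hb hx => (abs_net h ι x hb hx.uawNull.uawStarNull).weakStarNull⟩
    · exact ⟨fun H => of_net fun g hb _ h2 => (H _ g hb (h2.unNull hE')).weakStarNull,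
        fun h ι _ _ _ x hb hx => abs_net h ι x hb hx.uawNull.uawStarNull⟩
    · exact ⟨fun H => of_seq fun g hb _ h2 => H g hb (h2.unNull hE'),
        fun h x hb hx => (abs_seq h x hb hx.uawNull.uawStarNull).weakStarNull⟩
    · exact ⟨fun H => of_seq fun g hb _ h2 => (H g hb (h2.unNull hE')).weakStarNull,
        fun h x hb hx => abs_seq h x hb hx.uawNull.uawStarNull⟩
  have hPQ : ∀ p ∈ P ++ Q, (p ↔ OrderContinuousNorm E) := fun p hp =>
    (List.mem_append.1 hp).elim (hP p) (hQ p)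
  exact fun p hp q hq => (hPQ p hp).trans (hPQ q hq).symm
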